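/- Theorem (Higher dimensional case). Let $n$ and $k$ be positive integers and let $\Omega\subseteq\mathbb{R}^n$ be an open set. For $\alpha\in(0,1]$ let $C^{k,\alpha}(\Omega)$ be the set of all $g\in C^k(\Omega)$ whose partial derivatives of orders $1,\dots,k$ are bounded in $\Omega$ and whose partial derivatives of order $k$ are $\alpha$-Hölder continuous in $\Omega$; for such $g$ let $\mathrm{H\ddot{o}ld}_\alpha(g^{(k)},\Omega)$ be the maximum, over all partial derivatives $h$ of $g$ of order $k$, of the Hölder constants $\sup\{|h(y)-h(x)|/|y-x|^{\alpha} : x,y\in\Omega,\ x\neq y\}$. For $p\ge 1$, a bounded open set $\Omega'\subseteq\mathbb{R}^n$ and a measurable $\psi:\Omega'\to\mathbb{R}^n$ let $$\|\psi\|_{p,w,\Omega'}:=\sup_{M\ge 0} M\cdot\big[\mathrm{meas}\{x\in\Omega' : |\psi(x)|>M\}\big]^{1/p},$$ where $\mathrm{meas}$ is the Lebesgue measure, and let $L^p_w(\Omega')$ be the set of those $\psi$ for which this is finite. Then for every open set $\Omega'$ whose closure is compact and contained in $\Omega$ (in symbols $\Omega'\subset\subset\Omega$) there are constants $C_1$ and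 $C_2$, which depend only on $n$, $k$, $\Omega$ and $\Omega'$, such that the following holds. Let $\alpha\in(0,1]$, let $p$ be defined by $\frac1p+\frac1{k+\alpha}=1$, let $f:\Omega\to\mathbb{R}$ be continuous, and let $g\in C^{k,\alpha}(\Omega)$ satisfy $|f(x)|^{k+\alpha}=|g(x)|$ for every $x\in\Omega$. Then the distributional gradient $\nabla f$ of $f$ in $\Omega$ is a locally integrable function in $\Omega$ (which does not depend on $\Omega'$), it belongs to $L^p_w(\Omega')$, and $$\|\nabla f\|_{p,w,\Omega'}\le\max\Big\{C_1\,\big[\mathrm{H\ddot{o}ld}_\alpha(g^{(k)},\Omega)\big]^{1/(k+\alpha)},\ C_2\,\|\nabla g\|_{L^\infty(\Omega)}^{1/(k+\alpha)}\Big\}.$$ -/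

import Mathlib

open scoped ENNReal NNReal ContDiff Gradient
open MeasureTheory

namespace RootRegularity

noncomputable section

/-- The partial derivative `∂_{s 0} ∂_{s 1} ⋯ ∂_{s (j-1)} g` of order `j`. It is read only at points
near which `g` is of class `C^j`. -/
def partialDeriv {n j : ℕ} (s : Fin j → Fin n) (g : EuclideanSpace ℝ (Fin n) → ℝ)
    (x : EuclideanSpace ℝ (Fin n)) : ℝ :=
  iteratedFDeriv ℝ j g x (fun i => EuclideanSpace.single (s i) (1 : ℝ))

/-- The class `C^{k,α}(Ω)`: functions of class `C^k` on `Ω` whose partial derivatives of the orders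
`1, …, k` are bounded in `Ω`, and whose partial derivatives of order `k` are `α`-Hölder continuous
in `Ω`. -/
structure MemCkHolder {n : ℕ} (k : ℕ) (α : ℝ≥0) (g : EuclideanSpace ℝ (Fin n) → ℝ)
    (Ω : Set (EuclideanSpace ℝ (Fin n))) : Prop where
  contDiffOn : ContDiffOn ℝ k g Ω
  bounded : ∀ j : ℕ, 1 ≤ j → j ≤ k → ∀ s : Fin j → Fin n,
    ∃ B : ℝ, ∀ x ∈ Ω, |partialDeriv s g x| ≤ B
  holder : ∀ s : Fin k → Fin n, ∃ H : ℝ≥0, HolderOnWith H α (partialDeriv s g) Ω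

/-- The maximum, over all partial derivatives of `g` of order `k`, of their `α`-Hölder constants
in `Ω` (the smallest admissible constants, `∞` if there is none). -/
def holderConst {n : ℕ} (k : ℕ) (α : ℝ≥0) (g : EuclideanSpace ℝ (Fin n) → ℝ)
    (Ω : Set (EuclideanSpace ℝ (Fin n))) : ℝ≥0∞ :=
  ⨆ s : Fin k → Fin n, eHolderNorm α (fun x : Ω => partialDeriv s g x)

/-- The weak `L^p` quasinorm `sup_{M ≥ 0} M · meas {x ∈ Ω : |ψ x| > M} ^ (1/p)`. -/
def weakLpNorm {n : ℕ} (p : ℝ)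
    (ψ : EuclideanSpace ℝ (Fin n) → EuclideanSpace ℝ (Fin n))
    (Ω : Set (EuclideanSpace ℝ (Fin n))) : ℝ≥0∞ :=
  ⨆ M : ℝ≥0, (M : ℝ≥0∞) * volume {x ∈ Ω | (M : ℝ) < ‖ψ x‖} ^ (1 / p)

/-- The weak space `L^p_w(Ω)`, for vector fields. -/
def MemWeakLp {n : ℕ} (p : ℝ)
    (ψ : EuclideanSpace ℝ (Fin n) → EuclideanSpace ℝ (Fin n))
    (Ω : Set (EuclideanSpace ℝ (Fin n))) : Prop :=
  AEStronglyMeasurable ψ (volume.restrict Ω) ∧ weakLpNorm p ψ Ω < ⊤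

/-- `F` is the distributional gradient of `f` in the open set `Ω`: both are locally integrable
in `Ω`, and `∫ f ∂ᵢφ = - ∫ Fᵢ φ` for every `i` and every smooth `φ` with compact support in `Ω`. -/
structure HasWeakGradientOn {n : ℕ} (f : EuclideanSpace ℝ (Fin n) → ℝ)
    (F : EuclideanSpace ℝ (Fin n) → EuclideanSpace ℝ (Fin n))
    (Ω : Set (EuclideanSpace ℝ (Fin n))) : Prop where
  locallyIntegrableOn : LocallyIntegrableOn f Ω volume
  locallyIntegrableOn_gradient : LocallyIntegrableOn F Ω volume
  integral_eq : ∀ φ : EuclideanSpace ℝ (Fin n) → ℝ, ContDiff ℝ ∞ φ → HasCompactSupport φ →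
    tsupport φ ⊆ Ω → ∀ i : Fin n,
      ∫ x in Ω, f x * fderiv ℝ φ x (EuclideanSpace.single i (1 : ℝ)) = - ∫ x in Ω, F x i * φ x

end

end RootRegularity

/-!
On an interval where some derivative of order at most `k` of a function `g` of one variable has no
zeros, `g'` changes sign boundedly often. On each piece the signed root of `g` is injective, and it
maps the set where its derivative exceeds `M` into a short interval, so that this set is small.
If all derivatives have zeros, then `g'` is bounded by the Hölder constant of the `k`-th derivative
times a power of the length of the interval; cutting the interval in two and repeating, one gets the
weak-type estimate in dimension one. Fubini's theorem along coordinate lines gives it in `ℝⁿ`, with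
a constant that depends only on the room between the compact set and the boundary of the domain.

The pointwise gradient of `f` off the zeros of `g` is its weak gradient: the function
`f * g ^ 2 / (g ^ 2 + δ)` is differentiable also at the zeros of `g`, hence can be integrated by
parts, and `δ` tends to `0`.
-/

namespace RootRegularity

open Set Filter Topology

/-- The signed root `sign u * |u| ^ (1 / s)`, written as `u * |u| ^ (1 / s - 1)`. -/
noncomputable def signedRoot (s u : ℝ) : ℝ := u * |u| ^ (1 / s - 1)

lemma abs_signedRoot {s u : ℝ} (hu : u ≠ 0) : |signedRoot s u| = |u| ^ (1 / s) := by
  have hpos : 0 < |u| := abs_pos.2 hu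
  rw [signedRoot, abs_mul, abs_of_nonneg (Real.rpow_nonneg hpos.le _), Real.rpow_sub_one hpos.ne',
    mul_div_cancel₀ _ hpos.ne']

lemma injOn_signedRoot {s : ℝ} (hs : s ≠ 0) : InjOn (signedRoot s) {0}ᶜ := by
  intro u hu v hv h
  have hroot : |u| ^ (1 / s) = |v| ^ (1 / s) := by rw [← abs_signedRoot hu, ← abs_signedRoot hv, h]
  have habs : |u| = |v| :=
    (Real.rpow_left_inj (abs_nonneg u) (abs_nonneg v) (one_div_ne_zero hs)).1 hroot
  have hpos : 0 < |v| ^ (1 / s - 1) := Real.rpow_pos_of_pos (abs_pos.2 hv) _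
  simp only [signedRoot, habs] at h
  exact mul_right_cancel₀ hpos.ne' h

lemma hasDerivAt_signedRoot {s u : ℝ} (hu : u ≠ 0) :
    HasDerivAt (signedRoot s) (1 / s * |u| ^ (1 / s - 1)) u := by
  have hpos : 0 < |u| := abs_pos.2 hu
  have hsign : u * (SignType.sign u : ℝ) = |u| := self_mul_sign u
  refine ((hasDerivAt_id' u).mul
    ((hasDerivAt_abs hu).rpow_const (p := 1 / s - 1) (Or.inl hpos.ne'))).congr_deriv ?_
  calc 1 * |u| ^ (1 / s - 1) + u * (SignType.sign u * (1 / s - 1) * |u| ^ (1 / s - 1 - 1))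
      = |u| ^ (1 / s - 1) + (u * SignType.sign u) * (1 / s - 1) * |u| ^ (1 / s - 1 - 1) := by ring
    _ = 1 / s * |u| ^ (1 / s - 1) := by
      rw [hsign, Real.rpow_sub_one hpos.ne' (1 / s - 1)]; field_simp; ring

/-- The set on which `g` is nonzero and the derivative of its signed root of order `s` exceeds `M`
in absolute value, when `g'` is the derivative of `g`. The domain is arbitrary so that `g'` can also
be a directional derivative of a function of several variables. -/
def steepSet {X : Type*} (s M : ℝ) (g g' : X → ℝ) : Set X :=
  {x | g x ≠ 0 ∧ M < |1 / s * |g x| ^ (1 / s - 1) * g' x|}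

lemma isOpen_steepSet_inter {X : Type*} [TopologicalSpace X] {s M : ℝ} {g g' : X → ℝ} {U : Set X}
    (hU : IsOpen U) (hg : ContinuousOn g U) (hg' : ContinuousOn g' U) :
    IsOpen (steepSet s M g g' ∩ U) := by
  have hopen : IsOpen (U ∩ g ⁻¹' {0}ᶜ) := hg.isOpen_inter_preimage hU isOpen_compl_singleton
  have hcont : ContinuousOn (fun x => |1 / s * |g x| ^ (1 / s - 1) * g' x|) (U ∩ g ⁻¹' {0}ᶜ) := by
    refine ((continuousOn_const.mul ?_).mul (hg'.mono inter_subset_left)).abs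
    exact (hg.mono inter_subset_left).abs.rpow_const fun x hx => Or.inl (abs_ne_zero.2 hx.2)
  convert hcont.isOpen_inter_preimage hopen (isOpen_Ioi (a := M)) using 1
  ext x
  simp only [steepSet, mem_inter_iff, mem_ofPred_eq, mem_preimage, mem_Ioi, mem_compl_iff,
    mem_singleton_iff]
  tauto

lemma ne_zero_of_mem_steepSet {X : Type*} {s M : ℝ} (hM : 0 ≤ M) {g g' : X → ℝ} {x : X}
    (hx : x ∈ steepSet s M g g') : g' x ≠ 0 := by
  intro h0
  have h := hx.2
  rw [h0, mul_zero, abs_zero] at h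
  exact hM.not_gt h

/-- The values of the signed root of `g` on the steep set fill only a short interval: this is what
makes the steep set small wherever the root is injective. -/
lemma abs_signedRoot_le_of_mem_steepSet {X : Type*} {s p : ℝ} (hsp : s.HolderConjugate p)
    {A M : ℝ≥0} (hM : 0 < M) {g g' : X → ℝ} {x : X} (hx : x ∈ steepSet s M g g')
    (hA : |g' x| ≤ A) : |signedRoot s (g x)| ≤ ((A / M) ^ (p - 1) : ℝ≥0) := by
  obtain ⟨h0, hsteep⟩ := hx
  have hg : 0 < |g x| := abs_pos.2 h0
  have hp : 1 / p = 1 - 1 / s := by rw [one_div, one_div, hsp.one_sub_inv]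
  have hsub : |g x| ^ (1 / s - 1) * |g x| ^ (1 / p) = 1 := by
    rw [← Real.rpow_add hg, hp, sub_add_sub_cancel, sub_self, Real.rpow_zero]
  have hMA : (M : ℝ) ≤ |g x| ^ (1 / s - 1) * A := by
    rw [abs_mul, abs_mul, abs_of_nonneg hsp.one_div_nonneg, abs_of_nonneg (by positivity)] at hsteep
    refine hsteep.le.trans ?_
    gcongr
    exact mul_le_of_le_one_left (by positivity) ((div_le_one hsp.pos).2 hsp.lt.le)
  have hroot : |g x| ^ (1 / p) ≤ A / M := by
    rw [le_div_iff₀ (by exact_mod_cast hM)]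
    calc |g x| ^ (1 / p) * M ≤ |g x| ^ (1 / p) * (|g x| ^ (1 / s - 1) * A) := by gcongr
      _ = A := by rw [mul_left_comm, mul_comm _ (A : ℝ), mul_left_comm, hsub, mul_one]
  have hexp : 1 / p * (p - 1) = 1 / s := by
    rw [mul_sub, one_div_mul_cancel hsp.symm.ne_zero, hp]; ring
  calc |signedRoot s (g x)| = (|g x| ^ (1 / p)) ^ (p - 1) := by
        rw [abs_signedRoot h0, ← Real.rpow_mul hg.le, hexp]
    _ ≤ (A / M) ^ (p - 1) := by gcongr; exact hsp.symm.sub_one_pos.le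
    _ = ((A / M) ^ (p - 1) : ℝ≥0) := by push_cast; rfl

lemma mul_volume_le_volume_image_of_le_abs_deriv {f f' : ℝ → ℝ} {S : Set ℝ} {M : ℝ≥0}
    (hS : MeasurableSet S) (hf : ∀ t ∈ S, HasDerivWithinAt f (f' t) S t) (hinj : InjOn f S)
    (hM : ∀ t ∈ S, M ≤ |f' t|) : M * volume S ≤ volume (f '' S) := by
  have himage := lintegral_image_eq_lintegral_abs_deriv_mul hS hf hinj fun _ => 1
  simp only [mul_one, setLIntegral_one] at himage
  rw [himage, ← setLIntegral_const]
  exact setLIntegral_mono' hS fun t ht =>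
    ENNReal.coe_le_coe.2 (NNReal.le_toNNReal_of_coe_le (hM t ht))

lemma injOn_Ioo_of_hasDerivAt_ne_zero {a b : ℝ} {g g' : ℝ → ℝ}
    (hd : ∀ t ∈ Ioo a b, HasDerivAt g (g' t) t) (h0 : ∀ t ∈ Ioo a b, g' t ≠ 0) :
    InjOn g (Ioo a b) := by
  have hlt : ∀ x ∈ Ioo a b, ∀ y ∈ Ioo a b, x < y → g x ≠ g y := by
    intro x hx y hy hxy he
    have hsub : Icc x y ⊆ Ioo a b := Icc_subset_Ioo hx.1 hy.2
    obtain ⟨c, hc, hc0⟩ := exists_hasDerivAt_eq_zero hxy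
      (fun t ht => (hd t (hsub ht)).continuousAt.continuousWithinAt) he
      (fun t ht => hd t (hsub (Ioo_subset_Icc_self ht)))
    exact h0 c (hsub (Ioo_subset_Icc_self hc)) hc0
  intro x hx y hy he
  by_contra hne
  rcases lt_or_gt_of_ne hne with h | h
  · exact hlt x hx y hy h he
  · exact hlt y hy x hx h he.symm

lemma measure_inter_Ioo_le_add {μ : Measure ℝ} [NullSingletonClass μ] (S : Set ℝ) (a c b : ℝ) :
    μ (S ∩ Ioo a b) ≤ μ (S ∩ Ioo a c) + μ (S ∩ Ioo c b) := by
  have hsub : S ∩ Ioo a b ⊆ S ∩ Ioo a c ∪ S ∩ Ioo c b ∪ {c} := by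
    rintro t ⟨hS, ht⟩
    rcases lt_trichotomy t c with h | rfl | h
    · exact .inl (.inl ⟨hS, ht.1, h⟩)
    · exact .inr rfl
    · exact .inl (.inr ⟨hS, h, ht.2⟩)
  calc μ (S ∩ Ioo a b) ≤ μ (S ∩ Ioo a c ∪ S ∩ Ioo c b) + μ {c} :=
        (measure_mono hsub).trans (measure_union_le _ _)
    _ ≤ μ (S ∩ Ioo a c) + μ (S ∩ Ioo c b) := by
      rw [measure_singleton, add_zero]; exact measure_union_le _ _

lemma volume_steepSet_inter_Ioo_le_of_deriv_ne_zero {s p : ℝ} (hsp : s.HolderConjugate p)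
    {A M : ℝ≥0} (hM : 0 < M) {a b : ℝ} {g g' : ℝ → ℝ}
    (hd : ∀ t ∈ Ioo a b, HasDerivAt g (g' t) t) (hc : ContinuousOn g' (Ioo a b))
    (hA : ∀ t ∈ Ioo a b, |g' t| ≤ A) (h0 : ∀ t ∈ Ioo a b, g' t ≠ 0) :
    volume (steepSet s M g g' ∩ Ioo a b) ≤ (2 * (A ^ (p - 1) / M ^ p) : ℝ≥0) := by
  set S := steepSet s M g g' ∩ Ioo a b
  have hmeas : MeasurableSet S := (isOpen_steepSet_inter isOpen_Ioo
    (fun t ht => (hd t ht).continuousAt.continuousWithinAt) hc).measurableSet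
  have hinj : InjOn (signedRoot s ∘ g) S := (injOn_signedRoot hsp.ne_zero).comp
    ((injOn_Ioo_of_hasDerivAt_ne_zero hd h0).mono inter_subset_right) fun t ht => ht.1.1
  have hexpand : M * volume S ≤ volume (signedRoot s ∘ g '' S) :=
    mul_volume_le_volume_image_of_le_abs_deriv hmeas
      (fun t ht => ((hasDerivAt_signedRoot ht.1.1).comp t (hd t ht.2)).hasDerivWithinAt) hinj
      (fun t ht => ht.1.2.le)
  have himage : volume (signedRoot s ∘ g '' S) ≤ (2 * (A / M) ^ (p - 1) : ℝ≥0) := by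
    have hsub : signedRoot s ∘ g '' S ⊆
        Icc (-((A / M) ^ (p - 1) : ℝ≥0)) ((A / M) ^ (p - 1) : ℝ≥0) := by
      rintro _ ⟨t, ht, rfl⟩
      exact abs_le.1 (abs_signedRoot_le_of_mem_steepSet hsp hM ht.1 (hA t ht.2))
    refine (measure_mono hsub).trans_eq ?_
    rw [Real.volume_Icc, sub_neg_eq_add, ← two_mul, ← ENNReal.ofReal_coe_nnreal]
    push_cast; rfl
  have hscale : 2 * (A ^ (p - 1) / M ^ p) = 2 * (A / M) ^ (p - 1) / M := by
    rw [NNReal.div_rpow, NNReal.rpow_sub_one hM.ne']; field_simp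
  rw [hscale, ENNReal.coe_div hM.ne', ENNReal.le_div_iff_mul_le (.inl (by simpa using hM.ne'))
    (.inl ENNReal.coe_ne_top), mul_comm]
  exact hexpand.trans himage

/-- Each derivation costs a factor two, because the interval is cut at the only possible zero of the
preceding derivative. -/
lemma volume_steepSet_inter_Ioo_le_of_iterated_deriv_ne_zero {s p : ℝ} (hsp : s.HolderConjugate p)
    {A M : ℝ≥0} (hM : 0 < M) {G : ℕ → ℝ → ℝ} (j : ℕ) {a b : ℝ}
    (hd : ∀ i ≤ j, ∀ t ∈ Ioo a b, HasDerivAt (G i) (G (i + 1) t) t)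
    (hc : ContinuousOn (G 1) (Ioo a b)) (hA : ∀ t ∈ Ioo a b, |G 1 t| ≤ A)
    (h0 : ∀ t ∈ Ioo a b, G (j + 1) t ≠ 0) :
    volume (steepSet s M (G 0) (G 1) ∩ Ioo a b) ≤
      (2 ^ (j + 1) * (A ^ (p - 1) / M ^ p) : ℝ≥0) := by
  induction j generalizing a b with
  | zero =>
    simpa using volume_steepSet_inter_Ioo_le_of_deriv_ne_zero hsp hM (hd 0 le_rfl) hc hA h0
  | succ j ih =>
    have hinj := injOn_Ioo_of_hasDerivAt_ne_zero (hd (j + 1) le_rfl) h0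
    have hsubinterval : ∀ {a' b' : ℝ}, Ioo a' b' ⊆ Ioo a b → (∀ t ∈ Ioo a' b', G (j + 1) t ≠ 0) →
        volume (steepSet s M (G 0) (G 1) ∩ Ioo a' b') ≤
          (2 ^ (j + 1) * (A ^ (p - 1) / M ^ p) : ℝ≥0) := fun h h0' =>
      ih (fun i hi t ht => hd i (by lia) t (h ht)) (hc.mono h) (fun t ht => hA t (h ht)) h0'
    by_cases hz : ∃ c ∈ Ioo a b, G (j + 1) c = 0
    · obtain ⟨c, hc, hc0⟩ := hz
      have hl : Ioo a c ⊆ Ioo a b := Ioo_subset_Ioo_right hc.2.le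
      have hr : Ioo c b ⊆ Ioo a b := Ioo_subset_Ioo_left hc.1.le
      refine (measure_inter_Ioo_le_add _ a c b).trans ((add_le_add
        (hsubinterval hl fun t ht h => ht.2.ne (hinj (hl ht) hc (h.trans hc0.symm)))
        (hsubinterval hr fun t ht h => ht.1.ne' (hinj (hr ht) hc (h.trans hc0.symm)))).trans_eq ?_)
      rw [← ENNReal.coe_add, ← two_mul, ← mul_assoc, ← pow_succ']
    · push Not at hz
      refine (hsubinterval Subset.rfl hz).trans ?_
      gcongr
      · exact one_le_two
      · lia

/-- `G 1, …, G k` are the successive derivatives of `G 0` at the points of `I`, and `G k` is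
`α`-Hölder continuous on `I` with constant `H`. -/
structure IsHolderJet (k : ℕ) (α H : ℝ≥0) (G : ℕ → ℝ → ℝ) (I : Set ℝ) : Prop where
  hasDerivAt : ∀ i < k, ∀ t ∈ I, HasDerivAt (G i) (G (i + 1) t) t
  holderOnWith : HolderOnWith H α (G k) I

namespace IsHolderJet

variable {k : ℕ} {α H : ℝ≥0} {G : ℕ → ℝ → ℝ} {I J : Set ℝ}

lemma mono (hG : IsHolderJet k α H G I) (hJI : J ⊆ I) : IsHolderJet k α H G J where
  hasDerivAt i hi t ht := hG.hasDerivAt i hi t (hJI ht)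
  holderOnWith := hG.holderOnWith.mono hJI

lemma shift (hG : IsHolderJet (k + 1) α H G I) : IsHolderJet k α H (fun i => G (i + 1)) I where
  hasDerivAt i hi := hG.hasDerivAt (i + 1) (by lia)
  holderOnWith := hG.holderOnWith

lemma continuousOn (hG : IsHolderJet k α H G I) (hα : 0 < α) {i : ℕ} (hi : i ≤ k) :
    ContinuousOn (G i) I := by
  rcases hi.lt_or_eq with hi | rfl
  · exact fun t ht => (hG.hasDerivAt i hi t ht).continuousAt.continuousWithinAt
  · exact hG.holderOnWith.continuousOn hα

/-- If every derivative vanishes somewhere, integrating from the zeros recovers `G 0` from the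
Hölder bound on `G k`. -/
lemma abs_le_of_forall_exists_zero {a : ℝ} {ℓ : ℝ≥0} (hG : IsHolderJet k α H G (Ioo a (a + ℓ)))
    (hz : ∀ j ≤ k, ∃ c ∈ Ioo a (a + ℓ), G j c = 0) {t : ℝ} (ht : t ∈ Ioo a (a + ℓ)) :
    |G 0 t| ≤ (H * ℓ ^ (k + α : ℝ) : ℝ≥0) := by
  have hdist : ∀ c ∈ Ioo a (a + ℓ), ∀ t ∈ Ioo a (a + ℓ), |t - c| ≤ ℓ := fun c hc t ht =>
    abs_le.2 ⟨by linarith [hc.2, ht.1], by linarith [hc.1, ht.2]⟩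
  induction k generalizing G t with
  | zero =>
    obtain ⟨c, hc, hc0⟩ := hz 0 le_rfl
    calc |G 0 t| = dist (G 0 t) (G 0 c) := by rw [hc0, Real.dist_0_eq_abs]
      _ ≤ H * dist t c ^ (α : ℝ) := hG.holderOnWith.dist_le ht hc
      _ ≤ H * (ℓ : ℝ) ^ (α : ℝ) := by gcongr; exact hdist c hc t ht
      _ = (H * ℓ ^ ((0 : ℕ) + α : ℝ) : ℝ≥0) := by simp
  | succ k ih =>
    obtain ⟨c, hc, hc0⟩ := hz 0 (by lia)
    have hG1 : ∀ x ∈ Ioo a (a + ℓ), ‖G 1 x‖ ≤ (H * ℓ ^ (k + α : ℝ) : ℝ≥0) := fun x hx =>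
      ih hG.shift (fun j hj => hz (j + 1) (by lia)) hx
    calc |G 0 t| = ‖G 0 t - G 0 c‖ := by rw [hc0, sub_zero, Real.norm_eq_abs]
      _ ≤ (H * ℓ ^ (k + α : ℝ) : ℝ≥0) * ‖t - c‖ :=
        (convex_Ioo a (a + ℓ)).norm_image_sub_le_of_norm_hasDerivWithin_le
          (fun x hx => (hG.hasDerivAt 0 (by lia) x hx).hasDerivWithinAt) hG1 hc ht
      _ ≤ (H * ℓ ^ (k + α : ℝ) : ℝ≥0) * (ℓ : ℝ) := by gcongr; exact hdist c hc t ht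
      _ = (H * ℓ ^ ((k + 1 : ℕ) + α : ℝ) : ℝ≥0) := by
        rw [← NNReal.coe_mul, mul_assoc, ← NNReal.rpow_add_one' (by positivity), Nat.cast_add_one,
          add_right_comm]

lemma volume_steepSet_inter_Ioo_le_or_abs_le {p : ℝ} (hα : 0 < α) (hk : 0 < k)
    (hsp : (k + α : ℝ).HolderConjugate p) {M : ℝ≥0} (hM : 0 < M) {a : ℝ} {ℓ A : ℝ≥0}
    (hG : IsHolderJet k α H G (Ioo a (a + ℓ))) (hA : ∀ t ∈ Ioo a (a + ℓ), |G 1 t| ≤ A) :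
    volume (steepSet (k + α) M (G 0) (G 1) ∩ Ioo a (a + ℓ)) ≤
        (2 ^ k * (A ^ (p - 1) / M ^ p) : ℝ≥0) ∨
      ∀ t ∈ Ioo a (a + ℓ), |G 1 t| ≤ (H * ℓ ^ (k + α - 1 : ℝ) : ℝ≥0) := by
  by_cases hz : ∃ j < k, ∀ t ∈ Ioo a (a + ℓ), G (j + 1) t ≠ 0
  · obtain ⟨j, hj, h0⟩ := hz
    refine .inl ((volume_steepSet_inter_Ioo_le_of_iterated_deriv_ne_zero hsp hM j
      (fun i hi => hG.hasDerivAt i (by lia)) (hG.continuousOn hα (by lia)) hA h0).trans ?_)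
    gcongr
    · exact one_le_two
    · lia
  · refine .inr fun t ht => ?_
    push Not at hz
    obtain ⟨m, rfl⟩ : ∃ m, k = m + 1 := ⟨k - 1, by lia⟩
    convert hG.shift.abs_le_of_forall_exists_zero (fun j hj => hz j (by lia)) ht using 4
    push_cast; ring

/-- Bisection, stopped after `d` steps or as soon as some derivative has no zeros: on the intervals
of length `ℓ / 2 ^ d` that are left, the derivative is too small to be counted. -/
lemma volume_steepSet_inter_lt_abs_inter_Ioo_le {p : ℝ} (hα : 0 < α) (hk : 0 < k)
    (hsp : (k + α : ℝ).HolderConjugate p) {M : ℝ≥0} (hM : 0 < M) (d : ℕ) {a : ℝ} {ℓ A : ℝ≥0}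
    (hG : IsHolderJet k α H G (Ioo a (a + ℓ))) (hA : ∀ t ∈ Ioo a (a + ℓ), |G 1 t| ≤ A) :
    volume (steepSet (k + α) M (G 0) (G 1) ∩
        {t | (H * (ℓ / 2 ^ d) ^ (k + α - 1 : ℝ) : ℝ≥0) < |G 1 t|} ∩ Ioo a (a + ℓ)) ≤
      (2 ^ k * (max (A ^ (p - 1)) (2 * ℓ * H ^ (p - 1)) / M ^ p) : ℝ≥0) := by
  induction d generalizing a ℓ A with
  | zero =>
    rcases hG.volume_steepSet_inter_Ioo_le_or_abs_le hα hk hsp hM hA with hvol | hsmall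
    · exact (measure_mono (inter_subset_inter_left _ inter_subset_left)).trans
        (hvol.trans (by gcongr; exact le_max_left _ _))
    · refine (measure_mono_null (fun t ht => ?_) measure_empty).trans_le zero_le
      have hlarge := ht.1.2
      rw [mem_ofPred_eq, pow_zero, div_one] at hlarge
      exact hlarge.not_ge (hsmall t ht.2)
  | succ d ih =>
    rcases hG.volume_steepSet_inter_Ioo_le_or_abs_le hα hk hsp hM hA with hvol | hsmall
    · exact (measure_mono (inter_subset_inter_left _ inter_subset_left)).trans
        (hvol.trans (by gcongr; exact le_max_left _ _))
    have hscale : (H * ℓ ^ (k + α - 1 : ℝ)) ^ (p - 1) = ℓ * H ^ (p - 1) := by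
      have hexp : (k + α - 1 : ℝ) * (p - 1) = 1 := by
        rw [mul_sub, hsp.sub_one_mul_conj]; ring
      rw [NNReal.mul_rpow, ← NNReal.rpow_mul, hexp, NNReal.rpow_one, mul_comm]
    have hhalf : ∀ {b : ℝ}, Ioo b (b + (ℓ / 2 : ℝ≥0)) ⊆ Ioo a (a + ℓ) →
        volume (steepSet (k + α) M (G 0) (G 1) ∩
          {t | (H * (ℓ / 2 ^ (d + 1)) ^ (k + α - 1 : ℝ) : ℝ≥0) < |G 1 t|} ∩
            Ioo b (b + (ℓ / 2 : ℝ≥0))) ≤ (2 ^ k * (ℓ * H ^ (p - 1) / M ^ p) : ℝ≥0) := by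
      intro b hb
      have h := ih (hG.mono hb) fun t ht => hsmall t (hb ht)
      rwa [div_div, ← pow_succ', hscale, mul_div_cancel₀ _ two_ne_zero, max_self] at h
    have hmid : a + (ℓ / 2 : ℝ≥0) + (ℓ / 2 : ℝ≥0) = a + ℓ := by push_cast; ring
    have hleft := hhalf (b := a) (Ioo_subset_Ioo_right
      ((le_add_of_nonneg_right (NNReal.coe_nonneg _)).trans hmid.le))
    have hright := hhalf (b := a + (ℓ / 2 : ℝ≥0))
      (Ioo_subset_Ioo (le_add_of_nonneg_right (NNReal.coe_nonneg _)) hmid.le)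
    rw [hmid] at hright
    refine (measure_inter_Ioo_le_add _ a (a + (ℓ / 2 : ℝ≥0)) (a + ℓ)).trans
      ((add_le_add hleft hright).trans ?_)
    rw [← ENNReal.coe_add, ← two_mul, mul_left_comm, ← mul_div_assoc, ← mul_assoc 2 ℓ]
    gcongr
    exact le_max_right _ _

theorem volume_steepSet_inter_Ioo_le {p : ℝ} (hα : 0 < α) (hk : 0 < k)
    (hsp : (k + α : ℝ).HolderConjugate p) {M : ℝ≥0} (hM : 0 < M) {a : ℝ} {ℓ A : ℝ≥0}
    (hG : IsHolderJet k α H G (Ioo a (a + ℓ))) (hA : ∀ t ∈ Ioo a (a + ℓ), |G 1 t| ≤ A) :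
    volume (steepSet (k + α) M (G 0) (G 1) ∩ Ioo a (a + ℓ)) ≤
      (2 ^ k * (max (A ^ (p - 1)) (2 * ℓ * H ^ (p - 1)) / M ^ p) : ℝ≥0) := by
  set ε : ℕ → ℝ≥0 := fun d => H * (ℓ / 2 ^ d) ^ (k + α - 1 : ℝ)
  have hanti : Antitone ε := fun d e hde => by
    have hexp : 0 ≤ (k + α - 1 : ℝ) := hsp.sub_one_pos.le
    dsimp only [ε]
    gcongr
    exact one_le_two
  have hlim : Tendsto ε atTop (𝓝 0) := by
    have hlen : Tendsto (fun d : ℕ => ℓ / 2 ^ d) atTop (𝓝 0) := by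
      simpa only [inv_pow, ← div_eq_mul_inv, mul_zero] using
        (NNReal.tendsto_pow_atTop_nhds_zero_of_lt_one
          (inv_lt_one_of_one_lt₀ one_lt_two)).const_mul ℓ
    have hpow := (hlen.nnrpow (tendsto_const_nhds (x := (k + α - 1 : ℝ)))
      (.inr hsp.sub_one_pos)).const_mul H
    rwa [NNReal.zero_rpow hsp.sub_one_ne_zero, mul_zero] at hpow
  set S : ℕ → Set ℝ := fun d =>
    steepSet (k + α) M (G 0) (G 1) ∩ {t | ε d < |G 1 t|} ∩ Ioo a (a + ℓ)
  have hmono : Monotone S := fun d e hde t ht =>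
    ⟨⟨ht.1.1, (NNReal.coe_le_coe.2 (hanti hde)).trans_lt ht.1.2⟩, ht.2⟩
  have hcover : steepSet (k + α) M (G 0) (G 1) ∩ Ioo a (a + ℓ) ⊆ ⋃ d, S d := by
    rintro t ⟨ht, htI⟩
    have hpos : 0 < |G 1 t| := abs_pos.2 (ne_zero_of_mem_steepSet M.2 ht)
    obtain ⟨d, hd⟩ := ((NNReal.tendsto_coe.2 hlim).eventually_lt_const hpos).exists
    exact mem_iUnion.2 ⟨d, ⟨ht, hd⟩, htI⟩
  calc volume (steepSet (k + α) M (G 0) (G 1) ∩ Ioo a (a + ℓ)) ≤ volume (⋃ d, S d) :=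
        measure_mono hcover
    _ = ⨆ d, volume (S d) := hmono.measure_iUnion
    _ ≤ _ := iSup_le fun d => hG.volume_steepSet_inter_lt_abs_inter_Ioo_le hα hk hsp hM d hA

end IsHolderJet

section Slicing

variable {E : Type*} [NormedAddCommGroup E] [NormedSpace ℝ E]

section Fubini

variable [MeasurableSpace E] [BorelSpace E] [SecondCountableTopology E]

lemma measure_mul_volume_eq_lintegral_slice (μ : Measure E) [SFinite μ] [μ.IsAddRightInvariant]
    {S : Set E} (hS : MeasurableSet S) (e : E) (T : Set ℝ) :
    μ S * volume T = ∫⁻ x, volume ({t : ℝ | x + t • e ∈ S} ∩ T) ∂μ := by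
  have hmeas : Measurable fun q : ℝ × E => S.indicator (1 : E → ℝ≥0∞) (q.2 + q.1 • e) :=
    (measurable_one.indicator hS).comp (by fun_prop)
  have htranslate (t : ℝ) : ∫⁻ x, S.indicator (1 : E → ℝ≥0∞) (x + t • e) ∂μ = μ S := by
    rw [lintegral_add_right_eq_self (S.indicator 1), lintegral_indicator_one hS]
  have hslice (x : E) : ∫⁻ t in T, S.indicator (1 : E → ℝ≥0∞) (x + t • e) =
      volume ({t : ℝ | x + t • e ∈ S} ∩ T) := by
    have hmeas_slice : MeasurableSet {t : ℝ | x + t • e ∈ S} :=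
      (show Measurable fun t : ℝ => x + t • e by fun_prop) hS
    rw [← Measure.restrict_apply hmeas_slice, ← lintegral_indicator_one hmeas_slice]
    rfl
  calc μ S * volume T = ∫⁻ t in T, (∫⁻ x, S.indicator (1 : E → ℝ≥0∞) (x + t • e) ∂μ) := by
        simp only [htranslate, setLIntegral_const]
    _ = ∫⁻ x, (∫⁻ t in T, S.indicator (1 : E → ℝ≥0∞) (x + t • e)) ∂μ :=
        lintegral_lintegral_swap hmeas.aemeasurable
    _ = ∫⁻ x, volume ({t : ℝ | x + t • e ∈ S} ∩ T) ∂μ := by simp only [hslice]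

lemma measure_mul_le_of_forall_slice_le (μ : Measure E) [SFinite μ] [μ.IsAddRightInvariant]
    {S K : Set E} (hS : MeasurableSet S) (hSK : S ⊆ K) {e : E} (he : ‖e‖ = 1) {r : ℝ≥0} {B : ℝ≥0∞}
    (hB : ∀ x ∈ Metric.thickening r K, volume ({t : ℝ | x + t • e ∈ S} ∩ Ioo 0 (r : ℝ)) ≤ B) :
    μ S * r ≤ B * μ (Metric.thickening r K) := by
  calc μ S * r = ∫⁻ x, volume ({t : ℝ | x + t • e ∈ S} ∩ Ioo 0 (r : ℝ)) ∂μ := by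
        rw [← measure_mul_volume_eq_lintegral_slice μ hS, Real.volume_Ioo, sub_zero,
          ENNReal.ofReal_coe_nnreal]
    _ ≤ ∫⁻ x, (Metric.thickening r K).indicator (fun _ => B) x ∂μ := by
        refine lintegral_mono fun x => ?_
        by_cases hx : x ∈ Metric.thickening r K
        · rw [indicator_of_mem hx]
          exact hB x hx
        · refine (measure_mono_null (fun t ht => hx ?_) measure_empty).trans_le zero_le
          refine Metric.mem_thickening_iff.2 ⟨x + t • e, hSK ht.1, ?_⟩
          rw [dist_self_add_right, norm_smul, he, mul_one, Real.norm_of_nonneg ht.2.1.le]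
          exact ht.2.2
    _ = B * μ (Metric.thickening r K) :=
        lintegral_indicator_const Metric.isOpen_thickening.measurableSet B

end Fubini

lemma isometry_add_smul {e : E} (he : ‖e‖ = 1) (x : E) : Isometry fun t : ℝ => x + t • e :=
  Isometry.of_dist_eq fun t u => by
    rw [dist_add_left, dist_eq_norm, ← sub_smul, norm_smul, he, mul_one, ← dist_eq_norm]

lemma hasDerivAt_iteratedFDeriv_add_smul {g : E → ℝ} {k j : ℕ} (hj : j < k) {x e : E} {t : ℝ}
    (hg : ContDiffAt ℝ k g (x + t • e)) :
    HasDerivAt (fun u : ℝ => iteratedFDeriv ℝ j g (x + u • e) fun _ => e)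
      (iteratedFDeriv ℝ (j + 1) g (x + t • e) fun _ => e) t := by
  have hline : HasDerivAt (fun u : ℝ => x + u • e) e t := by
    simpa using ((hasDerivAt_id t).smul_const e).const_add x
  have hjet := (hg.differentiableAt_iteratedFDeriv (m := j) (by exact_mod_cast hj)).hasFDerivAt
  let evalAt := ContinuousMultilinearMap.apply ℝ (fun _ : Fin j => E) ℝ fun _ => e
  rw [iteratedFDeriv_succ_apply_left]
  exact evalAt.hasFDerivAt.comp_hasDerivAt t (hjet.comp_hasDerivAt t hline)

/-- Bounds for a function of class `C^k` in the direction `e`: on `Ω` its `k`-th derivative in the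
direction `e` is `α`-Hölder continuous with constant `H`, and its first one is at most `A`. -/
structure HasDirectionalBounds (k : ℕ) (α H A : ℝ≥0) (e : E) (g : E → ℝ) (Ω : Set E) : Prop where
  contDiffOn : ContDiffOn ℝ k g Ω
  holderOnWith : HolderOnWith H α (fun x => iteratedFDeriv ℝ k g x fun _ => e) Ω
  abs_fderiv_le : ∀ x ∈ Ω, |fderiv ℝ g x e| ≤ A

lemma HasDirectionalBounds.isHolderJet {k : ℕ} {α H A : ℝ≥0} {e : E} {g : E → ℝ} {Ω : Set E}
    (hg : HasDirectionalBounds k α H A e g Ω) (hΩ : IsOpen Ω) (he : ‖e‖ = 1) {x : E} {I : Set ℝ}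
    (hI : MapsTo (fun t : ℝ => x + t • e) I Ω) :
    IsHolderJet k α H (fun j t => iteratedFDeriv ℝ j g (x + t • e) fun _ => e) I where
  hasDerivAt j hj t ht :=
    hasDerivAt_iteratedFDeriv_add_smul hj (hg.contDiffOn.contDiffAt (hΩ.mem_nhds (hI ht)))
  holderOnWith t ht u hu := by
    rw [← (isometry_add_smul he x).edist_eq t u]
    exact hg.holderOnWith _ (hI ht) _ (hI hu)

variable [MeasurableSpace E] [BorelSpace E] [FiniteDimensional ℝ E]

lemma HasDirectionalBounds.measure_steepSet_inter_mul_le (μ : Measure E) [μ.IsAddHaarMeasure]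
    {k : ℕ} (hk : 0 < k) {α H A : ℝ≥0} (hα : 0 < α) {p : ℝ} (hsp : (k + α : ℝ).HolderConjugate p)
    {e : E} (he : ‖e‖ = 1) {g : E → ℝ} {Ω K : Set E} (hg : HasDirectionalBounds k α H A e g Ω)
    (hΩ : IsOpen Ω) (hK : MeasurableSet K) {r : ℝ≥0} (hr : 0 < r)
    (hKΩ : Metric.thickening (r + r) K ⊆ Ω) {M : ℝ≥0} (hM : 0 < M) :
    μ (steepSet (k + α) M g (fun x => fderiv ℝ g x e) ∩ K) * r ≤
      (2 ^ k * (max (A ^ (p - 1)) (2 * r * H ^ (p - 1)) / M ^ p) : ℝ≥0) *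
        μ (Metric.thickening r K) := by
  have hKsub : K ⊆ Ω := (Metric.self_subset_thickening (by positivity) K).trans hKΩ
  have hfderiv : ContinuousOn (fun x => fderiv ℝ g x e) Ω :=
    (hg.contDiffOn.continuousOn_fderiv_of_isOpen hΩ (by exact_mod_cast hk)).clm_apply
      continuousOn_const
  have hmeas : MeasurableSet (steepSet (k + α) M g (fun x => fderiv ℝ g x e) ∩ K) := by
    rw [← inter_eq_self_of_subset_right hKsub, ← inter_assoc]
    exact (isOpen_steepSet_inter hΩ hg.contDiffOn.continuousOn hfderiv).measurableSet.inter hK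
  refine measure_mul_le_of_forall_slice_le μ hmeas inter_subset_right he fun x hx => ?_
  have hline : MapsTo (fun t : ℝ => x + t • e) (Ioo 0 (0 + r)) Ω := fun t ht => by
    rw [zero_add] at ht
    refine hKΩ (Metric.thickening_thickening_subset _ _ K (Metric.mem_thickening_iff.2 ⟨x, hx, ?_⟩))
    rw [dist_self_add_left, norm_smul, he, mul_one, Real.norm_of_nonneg ht.1.le]
    exact ht.2
  refine (measure_mono fun t ht => ?_).trans
    ((hg.isHolderJet hΩ he hline).volume_steepSet_inter_Ioo_le hα hk hsp hM fun t ht => ?_)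
  · simpa only [steepSet, mem_inter_iff, mem_ofPred_eq, iteratedFDeriv_zero_apply, zero_add,
      iteratedFDeriv_one_apply] using And.intro ht.1.1 ht.2
  · rw [iteratedFDeriv_one_apply]
    exact hg.abs_fderiv_le _ (hline ht)

lemma exists_measure_steepSet_inter_le (μ : Measure E) [μ.IsAddHaarMeasure] {k : ℕ} (hk : 0 < k)
    {Ω K : Set E} (hΩ : IsOpen Ω) (hK : IsCompact K) (hKΩ : K ⊆ Ω) :
    ∃ D : ℝ≥0, ∀ {α H A : ℝ≥0} {p : ℝ} {e : E} {g : E → ℝ}, 0 < α →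
      (k + α : ℝ).HolderConjugate p → ‖e‖ = 1 → HasDirectionalBounds k α H A e g Ω →
      ∀ M : ℝ≥0, 0 < M → μ (steepSet (k + α) M g (fun x => fderiv ℝ g x e) ∩ K) ≤
        (D * (max H A ^ (p - 1) / M ^ p) : ℝ≥0) := by
  obtain ⟨δ, hδ, hδΩ⟩ := hK.exists_thickening_subset_open hΩ hKΩ
  lift δ to ℝ≥0 using hδ.le
  have hr : 0 < δ / 2 := by simpa using hδ
  generalize hδr : δ / 2 = r at hr
  obtain rfl : δ = r + r := by rw [← hδr, add_halves]
  have hvol : μ (Metric.thickening r K) ≠ ⊤ := hK.isBounded.thickening.measure_lt_top.ne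
  refine ⟨2 ^ k * max 1 (2 * r) * (μ (Metric.thickening r K)).toNNReal / r,
    fun {α H A p e g} hα hsp he hg M hM => ?_⟩
  have hbound : max (A ^ (p - 1)) (2 * r * H ^ (p - 1)) ≤
      max 1 (2 * r) * max H A ^ (p - 1) := by
    have hp : 0 ≤ p - 1 := hsp.symm.sub_one_pos.le
    refine max_le ?_ ?_
    · refine le_mul_of_one_le_of_le (le_max_left _ _) ?_
      gcongr
      exact le_max_right _ _
    · gcongr
      exacts [le_max_right _ _, le_max_left _ _]
  have hmain := hg.measure_steepSet_inter_mul_le μ hk hα hsp he hΩ hK.measurableSet hr hδΩ hM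
  rw [← ENNReal.coe_toNNReal hvol, ← ENNReal.coe_mul] at hmain
  rw [← ENNReal.le_div_iff_mul_le (.inl (by simpa using hr.ne')) (.inl ENNReal.coe_ne_top),
    ← ENNReal.coe_div hr.ne'] at hmain
  refine hmain.trans (ENNReal.coe_le_coe.2 ?_)
  calc 2 ^ k * (max (A ^ (p - 1)) (2 * r * H ^ (p - 1)) / M ^ p) *
        (μ (Metric.thickening r K)).toNNReal / r
      ≤ 2 ^ k * (max 1 (2 * r) * max H A ^ (p - 1) / M ^ p) *
        (μ (Metric.thickening r K)).toNNReal / r := by gcongr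
    _ = _ := by ring

end Slicing

section RootDerivative

variable {E : Type*} [NormedAddCommGroup E] [NormedSpace ℝ E]

/-- The derivative of a function `f` with `|f| ^ s = |g|`: the formula obtained by differentiating
this relation. It is `0` at the zeros of `g`, since `f x / 0 = 0`. -/
noncomputable def rootFDeriv (s : ℝ) (f g : E → ℝ) (x : E) : E →L[ℝ] ℝ :=
  (1 / s * (f x / g x)) • fderiv ℝ g x

lemma rootFDeriv_of_eq_zero {s : ℝ} {f g : E → ℝ} {x : E} (h0 : g x = 0) :
    rootFDeriv s f g x = 0 := by
  rw [rootFDeriv, h0, div_zero, mul_zero, zero_smul]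

lemma mem_steepSet_of_lt_abs_rootFDeriv {s M : ℝ} (hs : s ≠ 0) (hM : 0 ≤ M) {f g : E → ℝ} {x e : E}
    (hx : |f x| ^ s = |g x|) (h : M < |rootFDeriv s f g x e|) :
    x ∈ steepSet s M g (fun y => fderiv ℝ g y e) := by
  have h0 : g x ≠ 0 := fun h0 => by
    rw [rootFDeriv_of_eq_zero h0, zero_apply, abs_zero] at h
    exact hM.not_gt h
  have hquot : |f x / g x| = |g x| ^ (1 / s - 1) := by
    rw [Real.rpow_sub_one (abs_ne_zero.2 h0), abs_div, one_div,
      (Real.eq_rpow_inv (abs_nonneg _) (abs_nonneg _) hs).2 hx]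
  refine ⟨h0, h.trans_eq ?_⟩
  rw [rootFDeriv, smul_apply, smul_eq_mul, abs_mul, abs_mul, hquot, abs_mul, abs_mul,
    abs_of_nonneg (Real.rpow_nonneg (abs_nonneg _) _)]

end RootDerivative

section WeakLp

variable {n : ℕ} {p : ℝ} {ψ : EuclideanSpace ℝ (Fin n) → EuclideanSpace ℝ (Fin n)}
  {Ω Ω' : Set (EuclideanSpace ℝ (Fin n))}

lemma weakLpNorm_mono_set (hp : 0 ≤ p) (hΩ : Ω' ⊆ Ω) : weakLpNorm p ψ Ω' ≤ weakLpNorm p ψ Ω :=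
  iSup_mono fun M => by
    gcongr

lemma MemWeakLp.mono_set (hψ : MemWeakLp p ψ Ω) (hp : 0 ≤ p) (hΩ : Ω' ⊆ Ω) : MemWeakLp p ψ Ω' :=
  ⟨hψ.1.mono_set hΩ, (weakLpNorm_mono_set hp hΩ).trans_lt hψ.2⟩

lemma weakLpNorm_le_of_forall_volume_le (hp : 0 < p) {B : ℝ≥0}
    (h : ∀ M : ℝ≥0, 0 < M → volume {x ∈ Ω | (M : ℝ) < ‖ψ x‖} ≤ ((B / M) ^ p : ℝ≥0)) :
    weakLpNorm p ψ Ω ≤ B := by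
  refine iSup_le fun M => ?_
  rcases eq_zero_or_pos M with rfl | hM
  · simp
  calc (M : ℝ≥0∞) * volume {x ∈ Ω | (M : ℝ) < ‖ψ x‖} ^ (1 / p)
      ≤ M * ((B / M) ^ p : ℝ≥0) ^ (1 / p) := by gcongr; exact h M hM
    _ = B := by
      rw [← ENNReal.coe_rpow_of_nonneg _ (by positivity), ← NNReal.rpow_mul,
        mul_one_div_cancel hp.ne', NNReal.rpow_one, ← ENNReal.coe_mul, mul_div_cancel₀ _ hM.ne']

lemma volume_lt_norm_le_weakLpNorm_div_rpow (hp : 0 < p) {M : ℝ≥0} (hM : 0 < M) :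
    volume {x ∈ Ω | (M : ℝ) < ‖ψ x‖} ≤ (weakLpNorm p ψ Ω / M) ^ p := by
  have hle : (M : ℝ≥0∞) * volume {x ∈ Ω | (M : ℝ) < ‖ψ x‖} ^ (1 / p) ≤ weakLpNorm p ψ Ω :=
    le_iSup (fun M : ℝ≥0 => (M : ℝ≥0∞) * volume {x ∈ Ω | (M : ℝ) < ‖ψ x‖} ^ (1 / p)) M
  rw [← ENNReal.rpow_inv_le_iff hp, ← one_div, ENNReal.le_div_iff_mul_le
    (.inl (by simpa using hM.ne')) (.inl ENNReal.coe_ne_top), mul_comm]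
  exact hle

lemma MemWeakLp.integrableOn (hψ : MemWeakLp p ψ Ω) (hp : 1 < p) (hΩ : volume Ω ≠ ⊤) :
    IntegrableOn ψ Ω := by
  have hp0 : 0 < p := zero_lt_one.trans hp
  obtain ⟨B, hB⟩ : ∃ B : ℝ≥0, (B : ℝ≥0∞) = weakLpNorm p ψ Ω := ⟨_, ENNReal.coe_toNNReal hψ.2.ne⟩
  have htail : ∀ t : ℝ, 0 < t → volume.restrict Ω {x | t < ‖ψ x‖} ≤
      ENNReal.ofReal (B ^ p * t ^ (-p)) := fun t ht => by
    lift t to ℝ≥0 using ht.le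
    have hvol := volume_lt_norm_le_weakLpNorm_div_rpow (ψ := ψ) (Ω := Ω) hp0 (M := t) ht
    rw [Measure.restrict_apply₀ (nullMeasurableSet_lt aemeasurable_const hψ.1.norm.aemeasurable),
      inter_comm]
    refine hvol.trans_eq ?_
    rw [← hB, ← ENNReal.coe_div (by simpa using ht.ne'), ← ENNReal.coe_rpow_of_nonneg _ hp0.le,
      NNReal.div_rpow, div_eq_mul_inv, ← NNReal.rpow_neg, ← ENNReal.ofReal_coe_nnreal,
      NNReal.coe_mul, NNReal.coe_rpow, NNReal.coe_rpow]
  refine ⟨hψ.1, ?_⟩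
  rw [hasFiniteIntegral_iff_norm, lintegral_eq_lintegral_meas_lt _
    (Eventually.of_forall fun x => norm_nonneg _) hψ.1.norm.aemeasurable,
    ← Ioc_union_Ioi_eq_Ioi zero_le_one]
  refine (lintegral_union_le _ _ _).trans_lt (ENNReal.add_lt_top.2 ⟨?_, ?_⟩)
  · refine (lintegral_mono fun t => measure_mono (subset_univ _)).trans_lt ?_
    rw [setLIntegral_const, Measure.restrict_apply_univ, Real.volume_Ioc]
    exact ENNReal.mul_lt_top hΩ.lt_top ENNReal.ofReal_lt_top
  · exact (setLIntegral_mono' measurableSet_Ioi fun t ht => htail t (zero_lt_one.trans ht)).trans_lt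
      ((integrableOn_Ioi_rpow_of_lt (neg_lt_neg hp) zero_lt_one).const_mul _).lintegral_lt_top

end WeakLp

section RootGradient

variable {n : ℕ}

/-- The vector field representing `rootFDeriv s f g`; it is the weak gradient of `f`. -/
noncomputable def rootGradient (s : ℝ) (f g : EuclideanSpace ℝ (Fin n) → ℝ)
    (x : EuclideanSpace ℝ (Fin n)) : EuclideanSpace ℝ (Fin n) :=
  (InnerProductSpace.toDual ℝ _).symm (rootFDeriv s f g x)

lemma toDual_symm_apply_eq (L : EuclideanSpace ℝ (Fin n) →L[ℝ] ℝ) (i : Fin n) :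
    (InnerProductSpace.toDual ℝ _).symm L i = L (EuclideanSpace.single i 1) := by
  rw [← InnerProductSpace.toDual_symm_apply (𝕜 := ℝ), EuclideanSpace.inner_single_right]
  simp

lemma norm_le_sum_abs_apply (v : EuclideanSpace ℝ (Fin n)) : ‖v‖ ≤ ∑ i, |v i| := by
  rw [EuclideanSpace.norm_eq]
  refine Real.sqrt_le_iff.2 ⟨Finset.sum_nonneg fun i _ => abs_nonneg _, ?_⟩
  simp only [Real.norm_eq_abs]
  exact Finset.sum_sq_le_sq_sum_of_nonneg fun i _ => abs_nonneg _

lemma exists_div_lt_abs_apply {M : ℝ} (hM : 0 ≤ M) {v : EuclideanSpace ℝ (Fin n)} (h : M < ‖v‖) :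
    ∃ i, M / n < |v i| := by
  by_contra! hv
  refine h.not_ge ?_
  calc ‖v‖ ≤ ∑ i, |v i| := norm_le_sum_abs_apply v
    _ ≤ ∑ _i : Fin n, M / n := Finset.sum_le_sum fun i _ => hv i
    _ = n / n * M := by
      rw [Finset.sum_const, Finset.card_univ, Fintype.card_fin, nsmul_eq_mul]; ring
    _ ≤ M := mul_le_of_le_one_left hM (div_self_le_one _)

lemma aestronglyMeasurable_rootGradient {s : ℝ} {f g : EuclideanSpace ℝ (Fin n) → ℝ}
    {Ω : Set (EuclideanSpace ℝ (Fin n))} (hΩ : IsOpen Ω) (hf : ContinuousOn f Ω)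
    (hg : ContDiffOn ℝ 1 g Ω) :
    AEStronglyMeasurable (rootGradient s f g) (volume.restrict Ω) := by
  have hquot : AEStronglyMeasurable (fun x => 1 / s * (f x / g x)) (volume.restrict Ω) :=
    (((hf.aemeasurable hΩ.measurableSet).div
      (hg.continuousOn.aemeasurable hΩ.measurableSet)).const_mul _).aestronglyMeasurable
  have hfderiv : AEStronglyMeasurable (fderiv ℝ g) (volume.restrict Ω) :=
    (hg.continuousOn_fderiv_of_isOpen hΩ le_rfl).aestronglyMeasurable hΩ.measurableSet
  exact (InnerProductSpace.toDual ℝ _).symm.continuous.comp_aestronglyMeasurable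
    (hquot.smul hfderiv)

lemma exists_volume_lt_norm_rootGradient_le {k : ℕ} (hk : 0 < k)
    {Ω K : Set (EuclideanSpace ℝ (Fin n))} (hΩ : IsOpen Ω) (hK : IsCompact K) (hKΩ : K ⊆ Ω) :
    ∃ D : ℝ≥0, ∀ {α H A : ℝ≥0} {p : ℝ} {f g : EuclideanSpace ℝ (Fin n) → ℝ}, 0 < α →
      (k + α : ℝ).HolderConjugate p →
      (∀ i, HasDirectionalBounds k α H A (EuclideanSpace.single i (1 : ℝ)) g Ω) →
      (∀ x ∈ Ω, |f x| ^ (k + α : ℝ) = |g x|) → ∀ M : ℝ≥0, 0 < M →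
      volume {x ∈ K | (M : ℝ) < ‖rootGradient (k + α) f g x‖} ≤
        (D * (max H A ^ (p - 1) / (M / n) ^ p) : ℝ≥0) := by
  obtain ⟨D, hD⟩ := exists_measure_steepSet_inter_le volume hk hΩ hK hKΩ
  refine ⟨n * D, fun {α H A p f g} hα hsp hg hfg M hM => ?_⟩
  have hsub : {x ∈ K | (M : ℝ) < ‖rootGradient (k + α) f g x‖} ⊆
      ⋃ i, steepSet (k + α) (M / n : ℝ≥0) g
        (fun x => fderiv ℝ g x (EuclideanSpace.single i (1 : ℝ))) ∩ K := by
    rintro x ⟨hxK, hx⟩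
    obtain ⟨i, hi⟩ := exists_div_lt_abs_apply M.2 hx
    rw [rootGradient, toDual_symm_apply_eq] at hi
    exact mem_iUnion.2 ⟨i, mem_steepSet_of_lt_abs_rootFDeriv hsp.ne_zero (NNReal.coe_nonneg _)
      (hfg x (hKΩ hxK)) hi, hxK⟩
  calc volume {x ∈ K | (M : ℝ) < ‖rootGradient (k + α) f g x‖}
      ≤ ∑ i, volume (steepSet (k + α) (M / n : ℝ≥0) g
          (fun x => fderiv ℝ g x (EuclideanSpace.single i (1 : ℝ))) ∩ K) :=
        (measure_mono hsub).trans (measure_iUnion_fintype_le _ _)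
    _ ≤ ∑ _i : Fin n, ((D * (max H A ^ (p - 1) / (M / n) ^ p) : ℝ≥0) : ℝ≥0∞) :=
        Finset.sum_le_sum fun i _ => hD hα hsp (by simp) (hg i) (M / n)
          (div_pos hM (Nat.cast_pos.2 i.pos))
    _ = (n * D * (max H A ^ (p - 1) / (M / n) ^ p) : ℝ≥0) := by
        rw [Finset.sum_const, Finset.card_univ, Fintype.card_fin, nsmul_eq_mul, mul_assoc (n : ℝ≥0)]
        push_cast; rfl

theorem exists_weakLpNorm_rootGradient_le {k : ℕ} (hk : 0 < k)
    {Ω K : Set (EuclideanSpace ℝ (Fin n))} (hΩ : IsOpen Ω) (hK : IsCompact K) (hKΩ : K ⊆ Ω) :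
    ∃ C : ℝ≥0, ∀ {α H A : ℝ≥0} {p : ℝ} {f g : EuclideanSpace ℝ (Fin n) → ℝ}, 0 < α →
      (k + α : ℝ).HolderConjugate p →
      (∀ i, HasDirectionalBounds k α H A (EuclideanSpace.single i (1 : ℝ)) g Ω) →
      (∀ x ∈ Ω, |f x| ^ (k + α : ℝ) = |g x|) →
      weakLpNorm p (rootGradient (k + α) f g) K ≤ (C * max H A ^ (1 / (k + α) : ℝ) : ℝ≥0) := by
  obtain ⟨D, hD⟩ := exists_volume_lt_norm_rootGradient_le hk hΩ hK hKΩ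
  refine ⟨max 1 D * n, fun {α H A p f g} hα hsp hg hfg =>
    weakLpNorm_le_of_forall_volume_le hsp.symm.pos fun M hM =>
      (hD hα hsp hg hfg M hM).trans (ENNReal.coe_le_coe.2 ?_)⟩
  have hexp : 1 / (k + α : ℝ) * p = p - 1 := by
    rw [one_div_mul_eq_div, hsp.symm.div_conj_eq_sub_one]
  have hDp : D ≤ max 1 D ^ p :=
    (le_max_right 1 D).trans (by
      simpa only [NNReal.rpow_one] using
        NNReal.rpow_le_rpow_of_exponent_le (le_max_left 1 D) hsp.symm.lt.le)
  calc D * (max H A ^ (p - 1) / (M / n) ^ p)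
      ≤ max 1 D ^ p * (max H A ^ (p - 1) / (M / n) ^ p) := by gcongr
    _ = (max 1 D * n * max H A ^ (1 / (k + α) : ℝ) / M) ^ p := by
      rw [NNReal.div_rpow, NNReal.div_rpow, NNReal.mul_rpow, NNReal.mul_rpow, ← NNReal.rpow_mul,
        hexp, div_div_eq_mul_div]
      ring

end RootGradient

section RootHasFDerivAt

variable {E : Type*} [NormedAddCommGroup E] [NormedSpace ℝ E] {f g : E → ℝ} {s : ℝ} {x : E}

lemma hasFDerivAt_root (hs : s ≠ 0) (hf : ContinuousAt f x) (hg : DifferentiableAt ℝ g x)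
    (hfg : ∀ᶠ y in 𝓝 x, |f y| ^ s = |g y|) (h0 : g x ≠ 0) :
    HasFDerivAt f (rootFDeriv s f g x) x := by
  have hfx : f x ≠ 0 := fun h => h0 <| abs_eq_zero.1 <| by
    rw [← hfg.self_of_nhds, h, abs_zero, Real.zero_rpow hs]
  have hsign : ∀ᶠ y in 𝓝 x, SignType.sign (f y) = SignType.sign (f x) :=
    ((continuousAt_sign_of_ne_zero hfx).comp hf).eventually_mem
      ((isOpen_discrete {SignType.sign (f x)}).mem_nhds rfl)
  have hroot : f =ᶠ[𝓝 x] fun y => SignType.sign (f x) * |g y| ^ (1 / s) := by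
    filter_upwards [hfg, hsign] with y hy hy'
    rw [← hy', one_div, ← (Real.eq_rpow_inv (abs_nonneg _) (abs_nonneg _) hs).2 hy, sign_mul_abs]
  have hderiv := (((hasDerivAt_abs h0).rpow_const (p := 1 / s)
    (Or.inl (abs_ne_zero.2 h0))).comp_hasFDerivAt x hg.hasFDerivAt).const_mul
      (SignType.sign (f x) : ℝ)
  refine (hderiv.congr_of_eventuallyEq hroot).congr_fderiv ?_
  rw [rootFDeriv, smul_smul, Real.rpow_sub_one (abs_ne_zero.2 h0)]
  have hinv : (SignType.sign (g x) : ℝ) / |g x| = (g x)⁻¹ := by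
    rw [div_eq_iff (abs_ne_zero.2 h0), ← self_mul_sign, inv_mul_cancel_left₀ h0]
  congr 1
  linear_combination SignType.sign (f x) * |g x| ^ (1 / s) / s * hinv -
    1 / (s * g x) * hroot.self_of_nhds

lemma hasFDerivAt_mul_of_eq_zero {u : E → ℝ} {u' : E →L[ℝ] ℝ} (hf : ContinuousAt f x)
    (hu : HasFDerivAt u u' x) (h0 : u x = 0) :
    HasFDerivAt (fun y => f y * u y) (f x • u') x := by
  have hsub : (fun y => f y - f x) =o[𝓝 x] fun _ => (1 : ℝ) :=
    (Asymptotics.isLittleO_one_iff ℝ).2 (by simpa using hf.sub_const (f x))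
  have hrem : (fun y => (f y - f x) * u y) =o[𝓝 x] fun y => y - x := by
    simpa [h0] using hsub.mul_isBigO hu.isBigO_sub.norm_right
  refine HasFDerivAt.of_isLittleO (((hu.const_mul (f x)).isLittleO.add hrem).congr_left fun y => ?_)
  rw [h0]
  ring

/-- A factor vanishing to second order at `0`: the product of `damping δ ∘ g` with a root of `g` is
differentiable also at the zeros of `g`. It tends to `1` off `0` as `δ → 0`. -/
noncomputable def damping (δ u : ℝ) : ℝ :=
  u ^ 2 / (u ^ 2 + δ)

/-- The factor by which `damping δ ∘ g` changes the derivative of an `s`-th root of `g`. -/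
noncomputable def dampingFactor (s δ u : ℝ) : ℝ :=
  damping δ u * (1 + 2 * s * (1 - damping δ u))

lemma damping_nonneg {δ : ℝ} (hδ : 0 ≤ δ) (u : ℝ) : 0 ≤ damping δ u := by
  unfold damping
  positivity

lemma damping_le_one {δ : ℝ} (hδ : 0 ≤ δ) (u : ℝ) : damping δ u ≤ 1 :=
  div_le_one_of_le₀ (le_add_of_nonneg_right hδ) (by positivity)

lemma tendsto_damping {u : ℝ} (hu : u ≠ 0) : Tendsto (fun δ => damping δ u) (𝓝[>] 0) (𝓝 1) := by
  have hcont : ContinuousAt (fun δ => damping δ u) 0 :=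
    continuousAt_const.div (by fun_prop) (by simpa using hu)
  simpa [damping, hu] using hcont.tendsto.mono_left nhdsWithin_le_nhds

lemma hasDerivAt_damping {δ : ℝ} (hδ : 0 < δ) (u : ℝ) :
    HasDerivAt (damping δ) (2 * u * δ / (u ^ 2 + δ) ^ 2) u := by
  have hne : u ^ 2 + δ ≠ 0 := by positivity
  have hsq : HasDerivAt (fun u : ℝ => u ^ 2) (2 * u) u := by simpa using hasDerivAt_pow 2 u
  exact (hsq.div (hsq.add_const δ) hne).congr_deriv (by ring)

lemma continuous_damping {δ : ℝ} (hδ : 0 < δ) : Continuous (damping δ) :=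
  continuous_iff_continuousAt.2 fun u => (hasDerivAt_damping hδ u).continuousAt

lemma continuous_dampingFactor {δ : ℝ} (hδ : 0 < δ) : Continuous (dampingFactor s δ) := by
  have hdamp := continuous_damping hδ
  unfold dampingFactor
  fun_prop

lemma tendsto_dampingFactor {u : ℝ} (hu : u ≠ 0) :
    Tendsto (fun δ => dampingFactor s δ u) (𝓝[>] 0) (𝓝 1) := by
  have hdamp := tendsto_damping hu
  simpa [dampingFactor] using
    hdamp.mul (((hdamp.const_sub 1).const_mul (2 * s)).const_add 1)

lemma abs_damping_le_one {δ : ℝ} (hδ : 0 ≤ δ) (u : ℝ) : |damping δ u| ≤ 1 :=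
  (abs_of_nonneg (damping_nonneg hδ u)).trans_le (damping_le_one hδ u)

lemma abs_dampingFactor_le {δ : ℝ} (hs : 0 ≤ s) (hδ : 0 ≤ δ) (u : ℝ) :
    |dampingFactor s δ u| ≤ 1 + 2 * s := by
  have h0 := damping_nonneg hδ u
  have h1 := sub_nonneg.2 (damping_le_one hδ u)
  rw [dampingFactor, abs_of_nonneg (by positivity)]
  calc damping δ u * (1 + 2 * s * (1 - damping δ u))
      ≤ 1 * (1 + 2 * s * 1) := by gcongr <;> linarith
    _ = 1 + 2 * s := by ring

lemma hasFDerivAt_mul_damping {δ : ℝ} (hs : s ≠ 0) (hδ : 0 < δ) (hf : ContinuousAt f x)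
    (hg : DifferentiableAt ℝ g x) (hfg : ∀ᶠ y in 𝓝 x, |f y| ^ s = |g y|) :
    HasFDerivAt (fun y => f y * damping δ (g y))
      (dampingFactor s δ (g x) • rootFDeriv s f g x) x := by
  have hdamp := (hasDerivAt_damping hδ (g x)).comp_hasFDerivAt x hg.hasFDerivAt
  rcases eq_or_ne (g x) 0 with h0 | h0
  · refine (hasFDerivAt_mul_of_eq_zero hf hdamp (by simp [h0, damping])).congr_fderiv ?_
    simp [h0, rootFDeriv_of_eq_zero]
  · refine ((hasFDerivAt_root hs hf hg hfg h0).mul hdamp).congr_fderiv ?_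
    simp only [Function.comp_apply, rootFDeriv, smul_smul, ← add_smul]
    congr 1
    have hne : g x ^ 2 + δ ≠ 0 := by positivity
    unfold dampingFactor damping
    field_simp
    ring

end RootHasFDerivAt

section WeakDerivative

lemma integrable_mul_of_tsupport_subset {X : Type*} [TopologicalSpace X] [T2Space X]
    [SecondCountableTopology X] [MeasurableSpace X] [BorelSpace X] {μ : Measure X} {Ω : Set X}
    {u φ : X → ℝ} (hu : LocallyIntegrableOn u Ω μ)
    (hφ : Continuous φ) (hφc : HasCompactSupport φ) (hφΩ : tsupport φ ⊆ Ω) :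
    Integrable (fun x => u x * φ x) μ :=
  (integrableOn_iff_integrable_of_support_subset
      ((Function.support_mul_subset_right u φ).trans (subset_tsupport φ))).1
    ((hu.integrableOn_compact_subset hφΩ hφc).mul_continuousOn hφ.continuousOn hφc)

lemma tendsto_integral_mul_mul_of_bounded {X ι : Type*} [TopologicalSpace X] [T2Space X]
    [LocallyCompactSpace X] [SecondCountableTopology X] [MeasurableSpace X] [BorelSpace X]
    {μ : Measure X} {Ω : Set X} {u φ : X → ℝ} {c : ι → X → ℝ} {B : ℝ} {l : Filter ι}
    [l.IsCountablyGenerated] (hΩ : IsOpen Ω) (hu : LocallyIntegrableOn u Ω μ) (hφ : Continuous φ)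
    (hφc : HasCompactSupport φ) (hφΩ : tsupport φ ⊆ Ω) (hc : ∀ᶠ i in l, ContinuousOn (c i) Ω)
    (hB : ∀ᶠ i in l, ∀ x, |c i x| ≤ B)
    (hlim : ∀ x ∈ Ω, u x ≠ 0 → Tendsto (fun i => c i x) l (𝓝 1)) :
    Tendsto (fun i => ∫ x, c i x * u x * φ x ∂μ) l (𝓝 (∫ x, u x * φ x ∂μ)) := by
  have hint := integrable_mul_of_tsupport_subset hu hφ hφc hφΩ
  refine tendsto_integral_filter_of_dominated_convergence (fun x => B * ‖u x * φ x‖) ?_ ?_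
    (hint.norm.const_mul B) (ae_of_all _ fun x => ?_)
  · filter_upwards [hc] with i hi
    exact (integrable_mul_of_tsupport_subset (hu.continuousOn_mul hi hΩ.isLocallyClosed)
      hφ hφc hφΩ).aestronglyMeasurable
  · filter_upwards [hB] with i hi
    refine ae_of_all _ fun x => ?_
    rw [mul_assoc, norm_mul]
    gcongr
    exact hi x
  · by_cases hx : x ∈ Ω ∧ u x ≠ 0
    · simpa only [one_mul] using ((hlim x hx.1 hx.2).mul_const (u x)).mul_const (φ x)
    · have h0 : u x * φ x = 0 := by
        by_contra h
        exact hx ⟨hφΩ (subset_tsupport φ (right_ne_zero_of_mul h)), left_ne_zero_of_mul h⟩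
      simp only [mul_assoc, h0, mul_zero, tendsto_const_nhds]

variable {E : Type*} [NormedAddCommGroup E] [NormedSpace ℝ E] [FiniteDimensional ℝ E]
  [MeasurableSpace E] [BorelSpace E] {μ : Measure E} [μ.IsAddHaarMeasure] {Ω : Set E}
  {f g φ : E → ℝ} {s : ℝ} {v : E}

lemma integral_mul_damping_mul_fderiv {δ : ℝ} (hs : s ≠ 0) (hδ : 0 < δ)
    (hΩ : IsOpen Ω) (hf : ContinuousOn f Ω) (hg : DifferentiableOn ℝ g Ω)
    (hfg : ∀ x ∈ Ω, |f x| ^ s = |g x|)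
    (hint : LocallyIntegrableOn (fun x => rootFDeriv s f g x v) Ω μ)
    (hφ : ContDiff ℝ 1 φ) (hφc : HasCompactSupport φ) (hφΩ : tsupport φ ⊆ Ω) :
    ∫ x, damping δ (g x) * f x * fderiv ℝ φ x v ∂μ =
      -∫ x, dampingFactor s δ (g x) * rootFDeriv s f g x v * φ x ∂μ := by
  have hderiv : ∀ x ∈ Ω, HasFDerivAt (fun y => f y * damping δ (g y))
      (dampingFactor s δ (g x) • rootFDeriv s f g x) x := fun x hx =>
    hasFDerivAt_mul_damping hs hδ (hf.continuousAt (hΩ.mem_nhds hx))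
      (hg.differentiableAt (hΩ.mem_nhds hx)) (mem_of_superset (hΩ.mem_nhds hx) hfg)
  have hprod : (fun x => fderiv ℝ (fun y => f y * damping δ (g y)) x v * φ x) =
      fun x => dampingFactor s δ (g x) * rootFDeriv s f g x v * φ x := by
    ext x
    by_cases hx : x ∈ tsupport φ
    · rw [(hderiv x (hφΩ hx)).fderiv, smul_apply, smul_eq_mul]
    · rw [image_eq_zero_of_notMem_tsupport hx, mul_zero, mul_zero]
  have hloc : LocallyIntegrableOn (fun y => f y * damping δ (g y)) Ω μ :=
    (hf.mul ((continuous_damping hδ).comp_continuousOn hg.continuousOn)).locallyIntegrableOn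
      hΩ.measurableSet
  have hfactor : ContinuousOn (fun x => dampingFactor s δ (g x)) Ω :=
    (continuous_dampingFactor hδ).comp_continuousOn hg.continuousOn
  rw [← hprod]
  simp only [mul_comm (damping δ _)]
  refine integral_mul_fderiv_eq_neg_fderiv_mul_of_integrable ?_
    (integrable_mul_of_tsupport_subset hloc ?_ ?_ ?_)
    (integrable_mul_of_tsupport_subset hloc hφ.continuous hφc hφΩ)
    (fun x hx => (hderiv x (hφΩ hx)).differentiableAt)
    (fun x _ => hφ.differentiable one_ne_zero x)
  · rw [hprod]
    exact integrable_mul_of_tsupport_subset (hint.continuousOn_mul hfactor hΩ.isLocallyClosed)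
      hφ.continuous hφc hφΩ
  · exact (hφ.continuous_fderiv one_ne_zero).clm_apply continuous_const
  · exact hφc.fderiv_apply (𝕜 := ℝ) v
  · exact (tsupport_fderiv_apply_subset ℝ v).trans hφΩ

theorem integral_mul_fderiv_eq_neg_rootFDeriv_mul (hs : 0 < s)
    (hΩ : IsOpen Ω) (hf : ContinuousOn f Ω) (hg : DifferentiableOn ℝ g Ω)
    (hfg : ∀ x ∈ Ω, |f x| ^ s = |g x|)
    (hint : LocallyIntegrableOn (fun x => rootFDeriv s f g x v) Ω μ)
    (hφ : ContDiff ℝ 1 φ) (hφc : HasCompactSupport φ) (hφΩ : tsupport φ ⊆ Ω) :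
    ∫ x, f x * fderiv ℝ φ x v ∂μ = -∫ x, rootFDeriv s f g x v * φ x ∂μ := by
  have hpos : ∀ᶠ δ : ℝ in 𝓝[>] 0, 0 < δ := self_mem_nhdsWithin
  have hleft : Tendsto (fun δ => ∫ x, damping δ (g x) * f x * fderiv ℝ φ x v ∂μ) (𝓝[>] 0)
      (𝓝 (∫ x, f x * fderiv ℝ φ x v ∂μ)) :=
    tendsto_integral_mul_mul_of_bounded hΩ (hf.locallyIntegrableOn hΩ.measurableSet)
      ((hφ.continuous_fderiv one_ne_zero).clm_apply continuous_const)
      (hφc.fderiv_apply (𝕜 := ℝ) v) ((tsupport_fderiv_apply_subset ℝ v).trans hφΩ)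
      (hpos.mono fun δ hδ => (continuous_damping hδ).comp_continuousOn hg.continuousOn)
      (hpos.mono fun δ hδ x => abs_damping_le_one hδ.le (g x))
      fun x hx hfx => tendsto_damping fun h0 => hfx <| by
        simpa [h0, Real.rpow_eq_zero (abs_nonneg _) hs.ne'] using hfg x hx
  have hright : Tendsto (fun δ => ∫ x, dampingFactor s δ (g x) * rootFDeriv s f g x v * φ x ∂μ)
      (𝓝[>] 0) (𝓝 (∫ x, rootFDeriv s f g x v * φ x ∂μ)) :=
    tendsto_integral_mul_mul_of_bounded hΩ hint hφ.continuous hφc hφΩ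
      (hpos.mono fun δ hδ => (continuous_dampingFactor hδ).comp_continuousOn hg.continuousOn)
      (hpos.mono fun δ hδ x => abs_dampingFactor_le hs.le hδ.le (g x))
      fun x _ hx => tendsto_dampingFactor fun h0 => hx <| by rw [rootFDeriv_of_eq_zero h0]; rfl
  exact tendsto_nhds_unique hleft (hright.neg.congr' (hpos.mono fun δ hδ =>
    (integral_mul_damping_mul_fderiv hs.ne' hδ hΩ hf hg hfg hint hφ hφc hφΩ).symm))

end WeakDerivative

section WeakGradient

variable {n : ℕ} {Ω : Set (EuclideanSpace ℝ (Fin n))} {f g : EuclideanSpace ℝ (Fin n) → ℝ}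

lemma locallyIntegrableOn_of_memWeakLp {p : ℝ}
    {ψ : EuclideanSpace ℝ (Fin n) → EuclideanSpace ℝ (Fin n)} (hΩ : IsOpen Ω) (hp : 1 < p)
    (hψ : ∀ K ⊆ Ω, IsCompact K → MemWeakLp p ψ K) : LocallyIntegrableOn ψ Ω :=
  (locallyIntegrableOn_iff hΩ.isLocallyClosed).2 fun K hKΩ hK =>
    (hψ K hKΩ hK).integrableOn hp hK.measure_lt_top.ne

lemma contDiffOn_one_of_hasDirectionalBounds {k : ℕ} {α H A : ℝ≥0} (hk : 0 < k)
    (hg : ∀ i, HasDirectionalBounds k α H A (EuclideanSpace.single i (1 : ℝ)) g Ω) :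
    ContDiffOn ℝ 1 g Ω := by
  rcases isEmpty_or_nonempty (Fin n) with hn | ⟨⟨i⟩⟩
  · exact (contDiffOn_const (c := g 0)).congr fun x _ => congrArg g (Subsingleton.elim x 0)
  · exact (hg i).contDiffOn.of_le (by exact_mod_cast hk)

lemma memWeakLp_rootGradient {k : ℕ} {α H A : ℝ≥0} {p : ℝ} (hk : 0 < k) (hΩ : IsOpen Ω)
    {K : Set (EuclideanSpace ℝ (Fin n))} (hK : IsCompact K) (hKΩ : K ⊆ Ω) (hα : 0 < α)
    (hsp : (k + α : ℝ).HolderConjugate p) (hf : ContinuousOn f Ω)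
    (hg : ∀ i, HasDirectionalBounds k α H A (EuclideanSpace.single i (1 : ℝ)) g Ω)
    (hfg : ∀ x ∈ Ω, |f x| ^ (k + α : ℝ) = |g x|) :
    MemWeakLp p (rootGradient (k + α) f g) K := by
  obtain ⟨C, hC⟩ := exists_weakLpNorm_rootGradient_le hk hΩ hK hKΩ
  exact ⟨(aestronglyMeasurable_rootGradient hΩ hf
    (contDiffOn_one_of_hasDirectionalBounds hk hg)).mono_set hKΩ,
    (hC hα hsp hg hfg).trans_lt ENNReal.coe_lt_top⟩

theorem hasWeakGradientOn_rootGradient {s : ℝ} (hs : 0 < s) (hΩ : IsOpen Ω) (hf : ContinuousOn f Ω)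
    (hg : DifferentiableOn ℝ g Ω) (hfg : ∀ x ∈ Ω, |f x| ^ s = |g x|)
    (hint : LocallyIntegrableOn (rootGradient s f g) Ω) :
    HasWeakGradientOn f (rootGradient s f g) Ω where
  locallyIntegrableOn := hf.locallyIntegrableOn hΩ.measurableSet
  locallyIntegrableOn_gradient := hint
  integral_eq φ hφ hφc hφΩ i := by
    have hcoord : ∀ x, rootGradient s f g x i = rootFDeriv s f g x (EuclideanSpace.single i 1) :=
      fun x => toDual_symm_apply_eq _ i
    have hint_i : LocallyIntegrableOn (fun x => rootGradient s f g x i) Ω :=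
      (locallyIntegrableOn_iff hΩ.isLocallyClosed).2 fun K hKΩ hK =>
        (EuclideanSpace.proj (𝕜 := ℝ) i).integrable_comp (hint.integrableOn_compact_subset hKΩ hK)
    simp only [hcoord] at hint_i ⊢
    have hcompl : ∀ x, x ∉ Ω → x ∉ tsupport φ := fun x hx hφx => hx (hφΩ hφx)
    rw [setIntegral_eq_integral_of_forall_compl_eq_zero fun x hx => by
        rw [fderiv_of_notMem_tsupport ℝ (hcompl x hx), zero_apply, mul_zero],
      setIntegral_eq_integral_of_forall_compl_eq_zero fun x hx => by
        rw [image_eq_zero_of_notMem_tsupport (hcompl x hx), mul_zero]]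
    exact integral_mul_fderiv_eq_neg_rootFDeriv_mul hs hΩ hf hg hfg hint_i (hφ.of_le (by simp))
      hφc hφΩ

end WeakGradient

section MemCkHolder

variable {n k : ℕ} {Ω : Set (EuclideanSpace ℝ (Fin n))} {α : ℝ≥0}
  {g : EuclideanSpace ℝ (Fin n) → ℝ}

lemma enorm_le_eLpNorm_top_of_continuousOn {X F : Type*} [TopologicalSpace X] [MeasurableSpace X]
    [OpensMeasurableSpace X] {μ : Measure X} [μ.IsOpenPosMeasure] [NormedAddCommGroup F]
    {U : Set X} (hU : IsOpen U) {u : X → F} (hu : ContinuousOn u U) {x : X} (hx : x ∈ U) :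
    ‖u x‖ₑ ≤ eLpNorm u ⊤ (μ.restrict U) := by
  by_contra! h
  have hopen : IsOpen (U ∩ (fun y => ‖u y‖ₑ) ⁻¹' Ioi (eLpNorm u ⊤ (μ.restrict U))) :=
    hu.enorm.isOpen_inter_preimage hU isOpen_Ioi
  have hae : ∀ᵐ y ∂μ, y ∈ U → ‖u y‖ₑ ≤ eLpNorm u ⊤ (μ.restrict U) :=
    (ae_restrict_iff' hU.measurableSet).1 (eLpNorm_exponent_top (f := u) ▸ ae_le_eLpNormEssSup)
  refine (hopen.measure_pos μ ⟨x, hx, h⟩).ne' (measure_mono_null ?_ (ae_iff.1 hae))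
  rintro y ⟨hyU, hlt⟩ hle
  exact (hle hyU).not_gt hlt

lemma gradient_apply (g : EuclideanSpace ℝ (Fin n) → ℝ) (x : EuclideanSpace ℝ (Fin n))
    (i : Fin n) : (∇ g x) i = fderiv ℝ g x (EuclideanSpace.single i 1) :=
  toDual_symm_apply_eq _ i

namespace MemCkHolder

lemma memHolder_partialDeriv (hg : MemCkHolder k α g Ω) (s : Fin k → Fin n) :
    MemHolder α fun x : Ω => partialDeriv s g x := by
  obtain ⟨C, hC⟩ := hg.holder s
  exact ⟨C, fun x y => hC x x.2 y y.2⟩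

lemma holderConst_ne_top (hg : MemCkHolder k α g Ω) : holderConst k α g Ω ≠ ⊤ := by
  rw [holderConst, ← Finset.sup_univ_eq_iSup]
  exact ((Finset.sup_lt_iff ENNReal.zero_lt_top).2 fun s _ =>
    eHolderNorm_lt_top.2 (hg.memHolder_partialDeriv s)).ne

lemma holderOnWith_partialDeriv (hg : MemCkHolder k α g Ω) (s : Fin k → Fin n) :
    HolderOnWith (holderConst k α g Ω).toNNReal α (partialDeriv s g) Ω := by
  have hle : nnHolderNorm α (fun x : Ω => partialDeriv s g x) ≤ (holderConst k α g Ω).toNNReal :=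
    ENNReal.toNNReal_mono hg.holderConst_ne_top
      (le_iSup (fun s : Fin k → Fin n => eHolderNorm α fun x : Ω => partialDeriv s g x) s)
  intro x hx y hy
  exact ((hg.memHolder_partialDeriv s).holderWith ⟨x, hx⟩ ⟨y, hy⟩).trans
    (mul_le_mul_left (ENNReal.coe_le_coe.2 hle) _)

lemma eLpNorm_gradient_ne_top (hg : MemCkHolder k α g Ω) (hk : 0 < k) (hΩ : IsOpen Ω) :
    eLpNorm (∇ g) ⊤ (volume.restrict Ω) ≠ ⊤ := by
  choose B hB using fun i : Fin n => hg.bounded 1 le_rfl hk fun _ => i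
  have hbound : ∀ x ∈ Ω, ‖∇ g x‖ ≤ ∑ i, B i := fun x hx =>
    (norm_le_sum_abs_apply _).trans (Finset.sum_le_sum fun i _ => by
      simpa only [gradient_apply, partialDeriv, iteratedFDeriv_one_apply] using hB i x hx)
  exact (eLpNormEssSup_lt_top_of_ae_bound
    (ae_restrict_of_forall_mem hΩ.measurableSet hbound)).ne

lemma hasDirectionalBounds (hg : MemCkHolder k α g Ω) (hk : 0 < k) (hΩ : IsOpen Ω) (i : Fin n) :
    HasDirectionalBounds k α (holderConst k α g Ω).toNNReal
      (eLpNorm (∇ g) ⊤ (volume.restrict Ω)).toNNReal (EuclideanSpace.single i (1 : ℝ)) g Ω where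
  contDiffOn := hg.contDiffOn
  holderOnWith := hg.holderOnWith_partialDeriv fun _ => i
  abs_fderiv_le x hx := by
    have hg1 : ContDiffOn ℝ 1 g Ω := hg.contDiffOn.of_le (by exact_mod_cast hk)
    have hcont : ContinuousOn (∇ g) Ω :=
      (InnerProductSpace.toDual ℝ _).symm.continuous.comp_continuousOn
        (hg1.continuousOn_fderiv_of_isOpen hΩ le_rfl)
    have hle := ENNReal.toReal_mono (hg.eLpNorm_gradient_ne_top hk hΩ)
      (enorm_le_eLpNorm_top_of_continuousOn (μ := volume) hΩ hcont hx)
    rw [toReal_enorm] at hle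
    rw [← gradient_apply, ← Real.norm_eq_abs]
    exact (PiLp.norm_apply_le _ i).trans hle

end MemCkHolder

end MemCkHolder

end RootRegularity

theorem theorem2p4_general (n k : ℕ) (hk : 0 < k)
    (Ω : Set (EuclideanSpace ℝ (Fin n))) (hΩ : IsOpen Ω) :
    ∃ C : Set (EuclideanSpace ℝ (Fin n)) → ℝ≥0,
      ∀ α : ℝ≥0, 0 < α →
      ∀ p : ℝ, 1 / p + 1 / ((k : ℝ) + α) = 1 →
      ∀ (H A : ℝ≥0) (f g : EuclideanSpace ℝ (Fin n) → ℝ), ContinuousOn f Ω →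
        (∀ i, RootRegularity.HasDirectionalBounds k α H A
          (EuclideanSpace.single i (1 : ℝ)) g Ω) →
        (∀ x ∈ Ω, |f x| ^ ((k : ℝ) + α) = |g x|) →
        RootRegularity.HasWeakGradientOn f (RootRegularity.rootGradient (k + α) f g) Ω ∧
        ∀ Ω' : Set (EuclideanSpace ℝ (Fin n)), IsCompact (closure Ω') → closure Ω' ⊆ Ω →
          RootRegularity.MemWeakLp p (RootRegularity.rootGradient (k + α) f g) Ω' ∧
          RootRegularity.weakLpNorm p (RootRegularity.rootGradient (k + α) f g) Ω' ≤
            max (C Ω' * (H : ℝ≥0∞) ^ (1 / ((k : ℝ) + α)))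
              (C Ω' * (A : ℝ≥0∞) ^ (1 / ((k : ℝ) + α))) := by
  choose! C hC using fun Ω' (h : IsCompact (closure Ω') ∧ closure Ω' ⊆ Ω) =>
    RootRegularity.exists_weakLpNorm_rootGradient_le hk hΩ h.1 h.2
  refine ⟨C, fun α hα p hp H A f g hf hg hfg => ?_⟩
  have hsp : (k + α : ℝ).HolderConjugate p := Real.holderConjugate_iff.2
    ⟨lt_add_of_le_of_pos (by exact_mod_cast hk) hα, by rw [← hp, one_div, one_div, add_comm]⟩
  have hmem : ∀ K ⊆ Ω, IsCompact K →
      RootRegularity.MemWeakLp p (RootRegularity.rootGradient (k + α) f g) K :=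
    fun K hKΩ hK => RootRegularity.memWeakLp_rootGradient hk hΩ hK hKΩ hα hsp hf hg hfg
  have hint : LocallyIntegrableOn (RootRegularity.rootGradient (k + α) f g) Ω :=
    RootRegularity.locallyIntegrableOn_of_memWeakLp hΩ hsp.symm.lt hmem
  have hdiff := (RootRegularity.contDiffOn_one_of_hasDirectionalBounds hk hg).differentiableOn
    one_ne_zero
  refine ⟨RootRegularity.hasWeakGradientOn_rootGradient hsp.pos hΩ hf hdiff hfg hint,
    fun Ω' hcpt hsub =>
      ⟨(hmem _ hsub hcpt).mono_set hsp.symm.nonneg subset_closure, ?_⟩⟩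
  have hexp : 0 ≤ 1 / ((k : ℝ) + α) := hsp.one_div_nonneg
  calc RootRegularity.weakLpNorm p (RootRegularity.rootGradient (k + α) f g) Ω'
      ≤ RootRegularity.weakLpNorm p (RootRegularity.rootGradient (k + α) f g) (closure Ω') :=
        RootRegularity.weakLpNorm_mono_set hsp.symm.nonneg subset_closure
    _ ≤ (C Ω' * max H A ^ (1 / (k + α) : ℝ) : ℝ≥0) := hC Ω' ⟨hcpt, hsub⟩ hα hsp hg hfg
    _ = max (C Ω' * (H : ℝ≥0∞) ^ (1 / ((k : ℝ) + α)))
          (C Ω' * (A : ℝ≥0∞) ^ (1 / ((k : ℝ) + α))) := by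
      rw [(NNReal.monotone_rpow_of_nonneg hexp).map_max, mul_max, ENNReal.coe_max,
        ENNReal.coe_mul, ENNReal.coe_mul, ENNReal.coe_rpow_of_nonneg _ hexp,
        ENNReal.coe_rpow_of_nonneg _ hexp]

theorem theorem2p4 (n k : ℕ) (hn : 0 < n) (hk : 0 < k)
    (Ω : Set (EuclideanSpace ℝ (Fin n))) (hΩ : IsOpen Ω) :
    ∃ C₁ C₂ : Set (EuclideanSpace ℝ (Fin n)) → ℝ≥0,
      ∀ (α : ℝ≥0), 0 < α → α ≤ 1 →
      ∀ p : ℝ, 1 / p + 1 / ((k : ℝ) + α) = 1 →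
      ∀ f g : EuclideanSpace ℝ (Fin n) → ℝ,
        ContinuousOn f Ω → RootRegularity.MemCkHolder k α g Ω →
        (∀ x ∈ Ω, |f x| ^ ((k : ℝ) + α) = |g x|) →
        ∃ F : EuclideanSpace ℝ (Fin n) → EuclideanSpace ℝ (Fin n),
          RootRegularity.HasWeakGradientOn f F Ω ∧
          ∀ Ω' : Set (EuclideanSpace ℝ (Fin n)),
            IsOpen Ω' → IsCompact (closure Ω') → closure Ω' ⊆ Ω →
            RootRegularity.MemWeakLp p F Ω' ∧
            RootRegularity.weakLpNorm p F Ω' ≤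
              max (C₁ Ω' * RootRegularity.holderConst k α g Ω ^ (1 / ((k : ℝ) + α)))
                (C₂ Ω' * eLpNorm (∇ g) ⊤ (volume.restrict Ω) ^ (1 / ((k : ℝ) + α))) := by
  obtain ⟨C, hC⟩ := theorem2p4_general n k hk Ω hΩ
  refine ⟨C, C, fun α hα _ p hp f g hf hg hfg => ?_⟩
  have h := hC α hα p hp _ _ f g hf (hg.hasDirectionalBounds hk hΩ) hfg
  rw [ENNReal.coe_toNNReal hg.holderConst_ne_top,
    ENNReal.coe_toNNReal (hg.eLpNorm_gradient_ne_top hk hΩ)] at h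
  exact ⟨_, h.1, fun Ω' _ => h.2 Ω'⟩
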